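/- Let $d\ge 1$. Let $\mathcal G(\mathbb R^d)=\mathcal E_M(\mathbb R^d)/\mathcal N(\mathbb R^d)$ be the special Colombeau algebra. Here $\mathcal E_M(\mathbb R^d)$ is the algebra of nets $(u_\varepsilon)_{\varepsilon\in(0,1]}$ of smooth functions $u_\varepsilon:\mathbb R^d\to\mathbb C$ such that for every compact $K\subset\mathbb R^d$ and every $\beta\in\mathbb N_0^d$ there is $N\ge 0$ with $\sup_{x\in K}|\partial^\beta u_\varepsilon(x)|=O(\varepsilon^{-N})$ as $\varepsilon\to 0$, and $\mathcal N(\mathbb R^d)$ is the ideal of those nets such that for all $K$, all $\beta$ and all $m\ge 0$ one has $\sup_{x\in K}|\partial^\beta u_\varepsilon(x)|=O(\varepsilon^{m})$. Let $\widetilde{\mathbb C}$ be the ring of generalized complex numbers, i.e. nets $(c_\varepsilon)_{\varepsilon\in(0,1]}$ of complex numbers with $|c_\varepsilon|=O(\varepsilon^{-N})$ for some $N$, modulo those with $|c_\varepsilon|=O(\varepsilon^{m})$ for all $m$; it embeds in $\mathcal G(\mathbb R^d)$ as the constants, so that each polynomial in $\widetilde{\mathbb C}[x_1,\dots,x_d]$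 defines an element of $\mathcal G(\mathbb R^d)$. For $\alpha\in\mathbb R$, call $u\in\mathcal G(\mathbb R^d)$ homogeneous of degree $\alpha$ if for every real $\lambda>0$ the identity $u(\lambda x)=\lambda^\alpha u(x)$ holds in $\mathcal G(\mathbb R^d)$. Let $\alpha\in\mathbb R$ and let $u\in\mathcal G(\mathbb R^d)$ with $u\neq 0$. 1. If $u$ is homogeneous of degree $\alpha$, then $\alpha$ is a non-negative integer. 2. $u$ is homogeneous of degree $\alpha$ if and only if $\alpha$ is a non-negative integer and $u$ is (the element of $\mathcal G(\mathbb R^d)$ defined by) a homogeneous polynomial of degree $\alpha$ in $x_1,\dots,x_d$ with coefficients in $\widetilde{\mathbb C}$. -/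

import Mathlib

open scoped ContDiff Topology

noncomputable section

namespace Colombeau

/-- The parameter interval `(0,1]` of the regularisation parameter `ε`. -/
abbrev Eps : Type := Set.Ioc (0 : ℝ) 1

/-- The filter "`ε → 0`" on `(0,1]`. -/
def epsToZero : Filter Eps := Filter.comap (fun ε : Eps => (ε : ℝ)) (𝓝 0)

/-- The space `ℝ^d` with its Euclidean norm. -/
abbrev Space (d : ℕ) : Type := EuclideanSpace ℝ (Fin d)

lemma eps_pow_inv_le (ε : Eps) {N M : ℕ} (h : N ≤ M) :
    ((ε : ℝ) ^ N)⁻¹ ≤ ((ε : ℝ) ^ M)⁻¹ := by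
  have h0 : 0 < (ε : ℝ) := ε.2.1
  exact inv_anti₀ (pow_pos h0 _) (pow_le_pow_of_le_one h0.le ε.2.2 h)

lemma one_le_eps_pow_inv (ε : Eps) (N : ℕ) : 1 ≤ ((ε : ℝ) ^ N)⁻¹ := by
  simpa using eps_pow_inv_le ε (Nat.zero_le N)

/-! ### Generalized complex numbers -/

/-- A net of complex numbers with `|c_ε| = O(ε^{-N})` for some `N`. -/
def ModerateNum (c : Eps → ℂ) : Prop :=
  ∃ N : ℕ, ∃ C : ℝ, ∀ᶠ ε in epsToZero, ‖c ε‖ ≤ C * ((ε : ℝ) ^ N)⁻¹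

/-- A net of complex numbers with `|c_ε| = O(ε^m)` for every `m`. -/
def NegligibleNum (c : Eps → ℂ) : Prop :=
  ∀ m : ℕ, ∃ C : ℝ, ∀ᶠ ε in epsToZero, ‖c ε‖ ≤ C * (ε : ℝ) ^ m

lemma ModerateNum.add {a b : Eps → ℂ} (ha : ModerateNum a) (hb : ModerateNum b) :
    ModerateNum (a + b) := by
  obtain ⟨N, C, hC⟩ := ha
  obtain ⟨M, D, hD⟩ := hb
  refine ⟨N + M, |C| + |D|, ?_⟩
  filter_upwards [hC, hD] with ε h1 h2
  have e1 := eps_pow_inv_le ε (Nat.le_add_right N M)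
  have e2 := eps_pow_inv_le ε (Nat.le_add_left M N)
  have p1 : 0 ≤ ((ε : ℝ) ^ N)⁻¹ := zero_le_one.trans (one_le_eps_pow_inv ε N)
  have p2 : 0 ≤ ((ε : ℝ) ^ M)⁻¹ := zero_le_one.trans (one_le_eps_pow_inv ε M)
  calc ‖(a + b) ε‖ ≤ ‖a ε‖ + ‖b ε‖ := norm_add_le _ _
    _ ≤ C * ((ε : ℝ) ^ N)⁻¹ + D * ((ε : ℝ) ^ M)⁻¹ := add_le_add h1 h2
    _ ≤ |C| * ((ε : ℝ) ^ (N + M))⁻¹ + |D| * ((ε : ℝ) ^ (N + M))⁻¹ := by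
        gcongr
        · exact le_abs_self C
        · exact le_abs_self D
    _ = _ := by ring

lemma ModerateNum.mul {a b : Eps → ℂ} (ha : ModerateNum a) (hb : ModerateNum b) :
    ModerateNum (a * b) := by
  obtain ⟨N, C, hC⟩ := ha
  obtain ⟨M, D, hD⟩ := hb
  refine ⟨N + M, C * D, ?_⟩
  filter_upwards [hC, hD] with ε h1 h2
  calc ‖(a * b) ε‖ = ‖a ε‖ * ‖b ε‖ := norm_mul _ _
    _ ≤ (C * ((ε : ℝ) ^ N)⁻¹) * (D * ((ε : ℝ) ^ M)⁻¹) :=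
        mul_le_mul h1 h2 (norm_nonneg _) ((norm_nonneg _).trans h1)
    _ = _ := by rw [pow_add, mul_inv]; ring

lemma moderateNum_const (z : ℂ) : ModerateNum (fun _ => z) :=
  ⟨0, ‖z‖, Filter.Eventually.of_forall fun ε => by simp⟩

/-- The ring of moderate nets of complex numbers. -/
def moderateNumbers : Subalgebra ℂ (Eps → ℂ) where
  carrier := {c | ModerateNum c}
  mul_mem' := ModerateNum.mul
  add_mem' := ModerateNum.add
  algebraMap_mem' z := moderateNum_const z

/-- The ideal of negligible nets of complex numbers. -/
def negligibleNumbers : Ideal moderateNumbers where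
  carrier := {c | NegligibleNum (c : Eps → ℂ)}
  zero_mem' := fun m => ⟨0, Filter.Eventually.of_forall fun ε => by simp⟩
  add_mem' := by
    intro a b ha hb m
    obtain ⟨C, hC⟩ := ha m
    obtain ⟨D, hD⟩ := hb m
    refine ⟨C + D, ?_⟩
    filter_upwards [hC, hD] with ε h1 h2
    rw [add_mul]
    exact (norm_add_le _ _).trans (add_le_add h1 h2)
  smul_mem' := by
    intro a b hb m
    obtain ⟨N, C, hC⟩ : ModerateNum (a : Eps → ℂ) := a.2
    obtain ⟨D, hD⟩ := hb (N + m)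
    refine ⟨C * D, ?_⟩
    filter_upwards [hC, hD] with ε h1 h2
    have h0 : (ε : ℝ) ^ N ≠ 0 := pow_ne_zero _ ε.2.1.ne'
    calc ‖(a : Eps → ℂ) ε * (b : Eps → ℂ) ε‖ = ‖(a : Eps → ℂ) ε‖ * ‖(b : Eps → ℂ) ε‖ :=
          norm_mul _ _
      _ ≤ (C * ((ε : ℝ) ^ N)⁻¹) * (D * (ε : ℝ) ^ (N + m)) :=
          mul_le_mul h1 h2 (norm_nonneg _) ((norm_nonneg _).trans h1)
      _ = _ := by rw [pow_add]; field_simp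

/-- The ring of generalized complex numbers: moderate nets modulo negligible nets. -/
def GenComplex : Type := moderateNumbers ⧸ negligibleNumbers

instance : CommRing GenComplex :=
  inferInstanceAs (CommRing (moderateNumbers ⧸ negligibleNumbers))

/-- The class of a moderate net of complex numbers. -/
def GenComplex.mk : moderateNumbers →+* GenComplex := Ideal.Quotient.mk negligibleNumbers

/-! ### The special Colombeau algebra on `ℝ^d` -/

/-- A net of smooth functions `ℝ^d → ℂ` is moderate if for every compact `K` and every order `k`
there is an `N` such that the derivatives of order `k` are `O(ε^{-N})` uniformly on `K`.
The norm of the `k`-th Fréchet derivative controls, and is controlled by, the finitely many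
partial derivatives `∂^β` with `|β| = k`. -/
def Moderate {d : ℕ} (u : Eps → Space d → ℂ) : Prop :=
  (∀ ε, ContDiff ℝ ∞ (u ε)) ∧
    ∀ K : Set (Space d), IsCompact K → ∀ k : ℕ, ∃ N : ℕ, ∃ C : ℝ,
      ∀ᶠ ε in epsToZero, ∀ x ∈ K, ‖iteratedFDeriv ℝ k (u ε) x‖ ≤ C * ((ε : ℝ) ^ N)⁻¹

/-- A net of smooth functions `ℝ^d → ℂ` is negligible if for every compact `K`, every order `k`
and every `m` the derivatives of order `k` are `O(ε^m)` uniformly on `K`. -/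
def Negligible {d : ℕ} (u : Eps → Space d → ℂ) : Prop :=
  (∀ ε, ContDiff ℝ ∞ (u ε)) ∧
    ∀ K : Set (Space d), IsCompact K → ∀ k : ℕ, ∀ m : ℕ, ∃ C : ℝ,
      ∀ᶠ ε in epsToZero, ∀ x ∈ K, ‖iteratedFDeriv ℝ k (u ε) x‖ ≤ C * (ε : ℝ) ^ m

section Closure

variable {d : ℕ}

lemma norm_iteratedFDeriv_add_le' {f g : Space d → ℂ} (hf : ContDiff ℝ ∞ f)
    (hg : ContDiff ℝ ∞ g) (k : ℕ) (x : Space d) :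
    ‖iteratedFDeriv ℝ k (f + g) x‖ ≤ ‖iteratedFDeriv ℝ k f x‖ + ‖iteratedFDeriv ℝ k g x‖ := by
  have hk : ((k : ℕ∞) : WithTop ℕ∞) ≤ ∞ := by exact_mod_cast le_top
  rw [iteratedFDeriv_add_apply (hf.of_le hk).contDiffAt (hg.of_le hk).contDiffAt]
  exact norm_add_le _ _

/-- Uniform choice of the exponent and the constant for all orders up to `k`. -/
lemma Moderate.uniform {u : Eps → Space d → ℂ} (hu : Moderate u) {K : Set (Space d)}
    (hK : IsCompact K) (k : ℕ) : ∃ N : ℕ, ∃ C : ℝ, 0 ≤ C ∧ ∀ᶠ ε in epsToZero, ∀ x ∈ K,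
      ∀ j ≤ k, ‖iteratedFDeriv ℝ j (u ε) x‖ ≤ C * ((ε : ℝ) ^ N)⁻¹ := by
  induction k with
  | zero =>
    obtain ⟨N, C, hC⟩ := hu.2 K hK 0
    refine ⟨N, |C|, abs_nonneg _, ?_⟩
    filter_upwards [hC] with ε h x hx j hj
    obtain rfl : j = 0 := by omega
    exact (h x hx).trans (mul_le_mul_of_nonneg_right (le_abs_self C)
      (zero_le_one.trans (one_le_eps_pow_inv ε N)))
  | succ k ih =>
    obtain ⟨M, D, hD0, hD⟩ := ih
    obtain ⟨N, C, hC⟩ := hu.2 K hK (k + 1)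
    refine ⟨M + N, D + |C|, by positivity, ?_⟩
    filter_upwards [hC, hD] with ε h1 h2 x hx j hj
    have e1 := eps_pow_inv_le ε (Nat.le_add_right M N)
    have e2 := eps_pow_inv_le ε (Nat.le_add_left N M)
    have p1 := zero_le_one.trans (one_le_eps_pow_inv ε M)
    have p2 := zero_le_one.trans (one_le_eps_pow_inv ε N)
    have p3 := zero_le_one.trans (one_le_eps_pow_inv ε (M + N))
    rcases Nat.lt_or_ge k j with hkj | hkj
    · obtain rfl : j = k + 1 := by omega
      calc _ ≤ C * ((ε : ℝ) ^ N)⁻¹ := h1 x hx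
        _ ≤ (D + |C|) * ((ε : ℝ) ^ (M + N))⁻¹ :=
          mul_le_mul ((le_abs_self C).trans (by linarith)) e2 p2 (by positivity)
    · calc _ ≤ D * ((ε : ℝ) ^ M)⁻¹ := h2 x hx j hkj
        _ ≤ (D + |C|) * ((ε : ℝ) ^ (M + N))⁻¹ :=
          mul_le_mul (by linarith [abs_nonneg C]) e1 p1 (by positivity)

/-- Uniform choice of the constant for all orders up to `k`. -/
lemma Negligible.uniform {u : Eps → Space d → ℂ} (hu : Negligible u) {K : Set (Space d)}
    (hK : IsCompact K) (k m : ℕ) : ∃ C : ℝ, 0 ≤ C ∧ ∀ᶠ ε in epsToZero, ∀ x ∈ K,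
      ∀ j ≤ k, ‖iteratedFDeriv ℝ j (u ε) x‖ ≤ C * (ε : ℝ) ^ m := by
  induction k with
  | zero =>
    obtain ⟨C, hC⟩ := hu.2 K hK 0 m
    refine ⟨|C|, abs_nonneg _, ?_⟩
    filter_upwards [hC] with ε h x hx j hj
    obtain rfl : j = 0 := by omega
    exact (h x hx).trans (mul_le_mul_of_nonneg_right (le_abs_self C) (pow_nonneg ε.2.1.le _))
  | succ k ih =>
    obtain ⟨D, hD0, hD⟩ := ih
    obtain ⟨C, hC⟩ := hu.2 K hK (k + 1) m
    refine ⟨D + |C|, by positivity, ?_⟩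
    filter_upwards [hC, hD] with ε h1 h2 x hx j hj
    have p : 0 ≤ (ε : ℝ) ^ m := pow_nonneg ε.2.1.le _
    rcases Nat.lt_or_ge k j with hkj | hkj
    · obtain rfl : j = k + 1 := by omega
      exact (h1 x hx).trans (mul_le_mul_of_nonneg_right
        ((le_abs_self C).trans (by linarith)) p)
    · exact (h2 x hx j hkj).trans (mul_le_mul_of_nonneg_right
        (by linarith [abs_nonneg C]) p)

lemma Moderate.add {u v : Eps → Space d → ℂ} (hu : Moderate u) (hv : Moderate v) :
    Moderate (u + v) := by
  refine ⟨fun ε => (hu.1 ε).add (hv.1 ε), fun K hK k => ?_⟩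
  obtain ⟨N, C, hC0, hC⟩ := hu.uniform hK k
  obtain ⟨M, D, hD0, hD⟩ := hv.uniform hK k
  refine ⟨N + M, C + D, ?_⟩
  filter_upwards [hC, hD] with ε h1 h2 x hx
  have e1 := eps_pow_inv_le ε (Nat.le_add_right N M)
  have e2 := eps_pow_inv_le ε (Nat.le_add_left M N)
  calc ‖iteratedFDeriv ℝ k ((u + v) ε) x‖
      ≤ ‖iteratedFDeriv ℝ k (u ε) x‖ + ‖iteratedFDeriv ℝ k (v ε) x‖ :=
        norm_iteratedFDeriv_add_le' (hu.1 ε) (hv.1 ε) k x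
    _ ≤ C * ((ε : ℝ) ^ N)⁻¹ + D * ((ε : ℝ) ^ M)⁻¹ :=
        add_le_add (h1 x hx k le_rfl) (h2 x hx k le_rfl)
    _ ≤ C * ((ε : ℝ) ^ (N + M))⁻¹ + D * ((ε : ℝ) ^ (N + M))⁻¹ := by gcongr
    _ = _ := by ring

/-- Leibniz estimate: bounds on all derivatives up to order `k` multiply. -/
lemma norm_iteratedFDeriv_mul_le' {f g : Space d → ℂ} (hf : ContDiff ℝ ∞ f)
    (hg : ContDiff ℝ ∞ g) (k : ℕ) (x : Space d) {A B : ℝ}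
    (hA : ∀ j ≤ k, ‖iteratedFDeriv ℝ j f x‖ ≤ A) (hB : ∀ j ≤ k, ‖iteratedFDeriv ℝ j g x‖ ≤ B) :
    ‖iteratedFDeriv ℝ k (f * g) x‖ ≤ 2 ^ k * (A * B) := by
  have hk : ((k : ℕ∞) : WithTop ℕ∞) ≤ ∞ := by exact_mod_cast le_top
  have hA0 : 0 ≤ A := (norm_nonneg _).trans (hA 0 (Nat.zero_le k))
  calc ‖iteratedFDeriv ℝ k (f * g) x‖
      ≤ ∑ i ∈ Finset.range (k + 1), (k.choose i : ℝ) * ‖iteratedFDeriv ℝ i f x‖ *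
          ‖iteratedFDeriv ℝ (k - i) g x‖ := norm_iteratedFDeriv_mul_le hf hg x hk
    _ ≤ ∑ i ∈ Finset.range (k + 1), (k.choose i : ℝ) * (A * B) := by
        refine Finset.sum_le_sum fun i hi => ?_
        rw [mul_assoc]
        refine mul_le_mul_of_nonneg_left ?_ (Nat.cast_nonneg _)
        exact mul_le_mul (hA i (by simpa [Nat.lt_succ_iff] using hi)) (hB _ (Nat.sub_le _ _))
          (norm_nonneg _) hA0
    _ = 2 ^ k * (A * B) := by
        rw [← Finset.sum_mul]
        congr 1
        exact_mod_cast Nat.sum_range_choose k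

lemma Moderate.mul {u v : Eps → Space d → ℂ} (hu : Moderate u) (hv : Moderate v) :
    Moderate (u * v) := by
  refine ⟨fun ε => (hu.1 ε).mul (hv.1 ε), fun K hK k => ?_⟩
  obtain ⟨N, C, hC0, hC⟩ := hu.uniform hK k
  obtain ⟨M, D, hD0, hD⟩ := hv.uniform hK k
  refine ⟨N + M, 2 ^ k * (C * D), ?_⟩
  filter_upwards [hC, hD] with ε h1 h2 x hx
  refine (norm_iteratedFDeriv_mul_le' (hu.1 ε) (hv.1 ε) k x (h1 x hx) (h2 x hx)).trans_eq ?_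
  rw [pow_add, mul_inv]; ring

lemma Negligible.add {u v : Eps → Space d → ℂ} (hu : Negligible u) (hv : Negligible v) :
    Negligible (u + v) := by
  refine ⟨fun ε => (hu.1 ε).add (hv.1 ε), fun K hK k m => ?_⟩
  obtain ⟨C, hC⟩ := hu.2 K hK k m
  obtain ⟨D, hD⟩ := hv.2 K hK k m
  refine ⟨C + D, ?_⟩
  filter_upwards [hC, hD] with ε h1 h2 x hx
  rw [add_mul]
  exact (norm_iteratedFDeriv_add_le' (hu.1 ε) (hv.1 ε) k x).trans (add_le_add (h1 x hx) (h2 x hx))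

lemma Moderate.mul_negligible {u v : Eps → Space d → ℂ} (hu : Moderate u) (hv : Negligible v) :
    Negligible (u * v) := by
  refine ⟨fun ε => (hu.1 ε).mul (hv.1 ε), fun K hK k m => ?_⟩
  obtain ⟨N, C, hC0, hC⟩ := hu.uniform hK k
  obtain ⟨D, hD0, hD⟩ := hv.uniform hK k (N + m)
  refine ⟨2 ^ k * (C * D), ?_⟩
  filter_upwards [hC, hD] with ε h1 h2 x hx
  have h0 : (ε : ℝ) ^ N ≠ 0 := pow_ne_zero _ ε.2.1.ne'
  refine (norm_iteratedFDeriv_mul_le' (hu.1 ε) (hv.1 ε) k x (h1 x hx) (h2 x hx)).trans_eq ?_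
  rw [pow_add]; field_simp

/-- The net that is constantly equal to one smooth function is moderate. -/
lemma moderate_of_smooth {f : Space d → ℂ} (hf : ContDiff ℝ ∞ f) : Moderate (fun _ : Eps => f) := by
  refine ⟨fun _ => hf, fun K hK k => ?_⟩
  have hk : ((k : ℕ∞) : WithTop ℕ∞) ≤ ∞ := by exact_mod_cast le_top
  obtain ⟨C, hC⟩ := hK.exists_bound_of_continuousOn (hf.continuous_iteratedFDeriv hk).continuousOn
  exact ⟨0, C, Filter.Eventually.of_forall fun ε x hx => by simpa using hC x hx⟩

end Closure

/-- The ring of moderate nets of smooth functions on `ℝ^d`. -/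
def moderateFunctions (d : ℕ) : Subalgebra ℂ (Eps → Space d → ℂ) where
  carrier := {u | Moderate u}
  mul_mem' := Moderate.mul
  add_mem' := Moderate.add
  algebraMap_mem' z := moderate_of_smooth (f := fun _ => z) contDiff_const

/-- The ideal of negligible nets of smooth functions on `ℝ^d`. -/
def negligibleFunctions (d : ℕ) : Ideal (moderateFunctions d) where
  carrier := {u | Negligible (u : Eps → Space d → ℂ)}
  zero_mem' := ⟨fun _ => contDiff_const (c := (0 : ℂ)), fun K hK k m =>
    ⟨0, Filter.Eventually.of_forall fun ε x hx => by simp⟩⟩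
  add_mem' := Negligible.add
  smul_mem' := fun a _ hb => Moderate.mul_negligible a.2 hb

/-- The special Colombeau algebra on `ℝ^d`. -/
def GenFun (d : ℕ) : Type := moderateFunctions d ⧸ negligibleFunctions d

instance (d : ℕ) : CommRing (GenFun d) :=
  inferInstanceAs (CommRing (moderateFunctions d ⧸ negligibleFunctions d))

instance (d : ℕ) : Algebra ℝ (GenFun d) :=
  inferInstanceAs (Algebra ℝ (moderateFunctions d ⧸ negligibleFunctions d))

/-- The class of a moderate net of smooth functions. -/
def GenFun.mk (d : ℕ) : moderateFunctions d →+* GenFun d :=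
  Ideal.Quotient.mk (negligibleFunctions d)

/-! ### Constants, coordinates, polynomials and scaling -/

section Maps

variable (d : ℕ)

lemma norm_iteratedFDeriv_const_le (z : ℂ) (k : ℕ) (x : Space d) :
    ‖iteratedFDeriv ℝ k (fun _ : Space d => z) x‖ ≤ ‖z‖ := by
  rcases Nat.eq_zero_or_pos k with rfl | hk
  · simp
  · rw [iteratedFDeriv_const_of_ne hk.ne']; simp

/-- A net of numbers as a net of constant functions. -/
def constNet : moderateNumbers →+* moderateFunctions d where
  toFun c := ⟨fun ε _ => (c : Eps → ℂ) ε, fun _ => contDiff_const, fun K hK k => by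
    obtain ⟨N, C, hC⟩ : ModerateNum (c : Eps → ℂ) := c.2
    refine ⟨N, C, ?_⟩
    filter_upwards [hC] with ε h x hx
    exact (norm_iteratedFDeriv_const_le d _ k x).trans h⟩
  map_one' := rfl
  map_mul' _ _ := rfl
  map_zero' := rfl
  map_add' _ _ := rfl

/-- The embedding of the generalized complex numbers into the generalized functions as constants. -/
def constGen : GenComplex →+* GenFun d :=
  Ideal.quotientMap (I := negligibleNumbers) (negligibleFunctions d) (constNet d) (by
    intro c hc
    refine ⟨fun _ => contDiff_const, fun K hK k m => ?_⟩
    obtain ⟨C, hC⟩ := hc m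
    refine ⟨C, ?_⟩
    filter_upwards [hC] with ε h x hx
    exact (norm_iteratedFDeriv_const_le d _ k x).trans h)

/-- The generalized function given by the `i`-th coordinate `x ↦ x_i`. -/
def coordGen (i : Fin d) : GenFun d :=
  GenFun.mk d
    ⟨fun _ x => ((x i : ℝ) : ℂ), moderate_of_smooth
      (Complex.ofRealCLM.contDiff.comp (EuclideanSpace.proj (𝕜 := ℝ) i).contDiff)⟩

/-- The generalized function `x ↦ P(x)` defined by a polynomial in `d` variables with generalized
complex coefficients. -/
def polyGen (P : MvPolynomial (Fin d) GenComplex) : GenFun d :=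
  MvPolynomial.eval₂ (constGen d) (coordGen d) P

variable {d}

lemma norm_iteratedFDeriv_comp_smul (t : ℝ) {f : Space d → ℂ} (hf : ContDiff ℝ ∞ f) (k : ℕ)
    (x : Space d) : ‖iteratedFDeriv ℝ k (fun y => f (t • y)) x‖ =
      |t| ^ k * ‖iteratedFDeriv ℝ k f (t • x)‖ := by
  have hk : ((k : ℕ∞) : WithTop ℕ∞) ≤ ∞ := by exact_mod_cast le_top
  have h := congrFun (iteratedFDeriv_comp_const_smul (i := k) t (hf.of_le hk)) x
  exact (congrArg norm h).trans (by rw [norm_smul, norm_pow, Real.norm_eq_abs])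

/-- The net `(x ↦ u_ε(t x))_ε`. -/
def scaleNet (t : ℝ) : moderateFunctions d →+* moderateFunctions d where
  toFun u := ⟨fun ε x => (u : Eps → Space d → ℂ) ε (t • x),
    fun ε => (u.2.1 ε).comp (contDiff_const_smul t), fun K hK k => by
      obtain ⟨N, C, hC⟩ := u.2.2 _ (hK.image (continuous_const_smul t)) k
      refine ⟨N, |t| ^ k * C, ?_⟩
      filter_upwards [hC] with ε h x hx
      rw [norm_iteratedFDeriv_comp_smul t (u.2.1 ε), mul_assoc]
      exact mul_le_mul_of_nonneg_left (h _ ⟨x, hx, rfl⟩) (by positivity)⟩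
  map_one' := rfl
  map_mul' _ _ := rfl
  map_zero' := rfl
  map_add' _ _ := rfl

/-- The generalized function `x ↦ u(t x)`, for a real number `t`. -/
def scale (t : ℝ) : GenFun d →+* GenFun d :=
  Ideal.quotientMap (I := negligibleFunctions d) (negligibleFunctions d) (scaleNet t) (by
    intro u hu
    refine ⟨fun ε => (hu.1 ε).comp (contDiff_const_smul t), fun K hK k m => ?_⟩
    obtain ⟨C, hC⟩ := hu.2 _ (hK.image (continuous_const_smul t)) k m
    refine ⟨|t| ^ k * C, ?_⟩
    filter_upwards [hC] with ε h x hx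
    refine (norm_iteratedFDeriv_comp_smul t (hu.1 ε) k x).trans_le ?_
    rw [mul_assoc]
    exact mul_le_mul_of_nonneg_left (h _ ⟨x, hx, rfl⟩) (by positivity))

/-- `u` is homogeneous of degree `α`: for every real `t > 0`, `u(t x) = t^α u(x)` holds in the
Colombeau algebra. -/
def IsHomogeneousOfDegree (u : GenFun d) (α : ℝ) : Prop :=
  ∀ t : ℝ, 0 < t → scale t u = (t ^ α : ℝ) • u

end Maps

end Colombeau

end

/-! For `0 < |t| < 1`, a nonzero eigenvector of `scale t` is already a homogeneous polynomial. On a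
closed ball the maximum principle excludes eigenvalues of absolute value greater than `1`. A
partial derivative divides the eigenvalue by `t`, so iterated derivatives must reach a nonzero
constant, whose eigenvalue is `1`: the eigenvalue of `u` is `t ^ k`. By induction on `k`, Euler's
identity `∑ i, x_i ∂_i u = k u` holds, since all partial derivatives of the difference vanish while
its eigenvalue is not `1`; dividing by `k` then rebuilds the polynomial from its partial
derivatives. -/

noncomputable section

namespace Colombeau

section NormedSpace

variable {E F : Type*} [NormedAddCommGroup F] [NormedSpace ℝ F]

/- At a point `y` where `‖g‖` is maximal, `|c| ‖g y‖ ≤ δ + |a| ‖g (T y)‖ ≤ δ + |a| ‖g y‖`. -/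
lemma norm_le_div_of_norm_smul_comp_sub_smul_le {X : Type*} [TopologicalSpace X] {K : Set X}
    (hK : IsCompact K) {T : X → X} (hT : Set.MapsTo T K K) {g : X → F} (hg : ContinuousOn g K)
    {a c δ : ℝ} (hac : |a| < |c|) (h : ∀ x ∈ K, ‖a • g (T x) - c • g x‖ ≤ δ) {x : X}
    (hx : x ∈ K) : ‖g x‖ ≤ δ / (|c| - |a|) := by
  obtain ⟨y, hy, hmax⟩ := hK.exists_isMaxOn ⟨x, hx⟩ hg.norm
  refine (hmax hx).trans ((le_div_iff₀ (sub_pos.2 hac)).2 ?_)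
  have hTy : |a| * ‖g (T y)‖ ≤ |a| * ‖g y‖ :=
    mul_le_mul_of_nonneg_left (hmax (hT hy)) (abs_nonneg a)
  have hdiff := (norm_sub_norm_le (c • g y) (a • g (T y))).trans
    ((norm_sub_rev _ _).trans_le (h y hy))
  rw [norm_smul, norm_smul, Real.norm_eq_abs, Real.norm_eq_abs] at hdiff
  linarith

section

variable [NormedAddCommGroup E] [NormedSpace ℝ E]

lemma contDiff_natCast_of_smooth {f : E → F} (hf : ContDiff ℝ ∞ f) (k : ℕ) : ContDiff ℝ k f :=
  hf.of_le (by exact_mod_cast le_top)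

lemma iteratedFDeriv_comp_smul_sub_smul {f : E → F} {k : ℕ} (hf : ContDiff ℝ k f) (t c : ℝ)
    (x : E) : iteratedFDeriv ℝ k (fun y => f (t • y) - c • f y) x =
      t ^ k • iteratedFDeriv ℝ k f (t • x) - c • iteratedFDeriv ℝ k f x := by
  have hscale : ContDiff ℝ k fun y => f (t • y) := hf.comp (contDiff_const_smul t)
  rw [fun_iteratedFDeriv_sub_apply hscale.contDiffAt (hf.const_smul c).contDiffAt,
    iteratedFDeriv_comp_const_smul t hf, iteratedFDeriv_const_smul_apply' hf.contDiffAt]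

lemma norm_iteratedFDeriv_fderiv_apply_le {f : E → F} {k : ℕ} (hf : ContDiff ℝ (k + 1) f)
    (v x : E) : ‖iteratedFDeriv ℝ k (fun y => fderiv ℝ f y v) x‖ ≤
      ‖v‖ * ‖iteratedFDeriv ℝ (k + 1) f x‖ := by
  rw [← norm_iteratedFDeriv_fderiv]
  exact norm_iteratedFDeriv_clm_apply_const (hf.fderiv_right le_rfl).contDiffAt le_rfl

lemma fderiv_fderiv_apply_comm {f : E → F} (hf : ContDiff ℝ 2 f) (v w x : E) :
    fderiv ℝ (fun y => fderiv ℝ f y v) x w = fderiv ℝ (fun y => fderiv ℝ f y w) x v := by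
  have hf' : DifferentiableAt ℝ (fderiv ℝ f) x :=
    (hf.fderiv_right (m := 1) (by norm_num)).differentiable one_ne_zero x
  have hsymm : IsSymmSndFDerivAt ℝ f x := hf.contDiffAt.isSymmSndFDerivAt (by simp)
  have hsecond (v w : E) :
      fderiv ℝ (fun y => fderiv ℝ f y v) x w = fderiv ℝ (fderiv ℝ f) x w v := by
    rw [fderiv_clm_apply hf' (differentiableAt_const v)]
    simp
  rw [hsecond, hsecond, hsymm.eq]

end

lemma norm_iteratedFDeriv_succ_le_sum {ι : Type*} [NormedAddCommGroup E] [InnerProductSpace ℝ E]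
    [Fintype ι] (b : OrthonormalBasis ι ℝ E) {f : E → F} {k : ℕ} (hf : ContDiff ℝ (k + 1) f)
    (x : E) : ‖iteratedFDeriv ℝ (k + 1) f x‖ ≤
      ∑ i, ‖iteratedFDeriv ℝ k (fun y => fderiv ℝ f y (b i)) x‖ := by
  refine ContinuousMultilinearMap.opNorm_le_bound (by positivity) fun m => ?_
  have hexpand : iteratedFDeriv ℝ (k + 1) f x m = ∑ i, inner ℝ (b i) (m (Fin.last k)) •
      iteratedFDeriv ℝ k (fun y => fderiv ℝ f y (b i)) x (Fin.init m) := by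
    simp_rw [iteratedFDeriv_clm_apply_const_apply (hf.fderiv_right le_rfl) le_rfl, ← map_smul,
      ← map_sum, b.sum_repr', iteratedFDeriv_succ_apply_right]
  rw [hexpand, Finset.sum_mul]
  refine norm_sum_le_of_le _ fun i _ => ?_
  have hcoord : ‖inner ℝ (b i) (m (Fin.last k))‖ ≤ ‖m (Fin.last k)‖ := by
    simpa using norm_inner_le_norm (𝕜 := ℝ) (b i) (m (Fin.last k))
  calc ‖inner ℝ (b i) (m (Fin.last k)) •
        iteratedFDeriv ℝ k (fun y => fderiv ℝ f y (b i)) x (Fin.init m)‖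
      ≤ ‖m (Fin.last k)‖ * (‖iteratedFDeriv ℝ k (fun y => fderiv ℝ f y (b i)) x‖ *
          ∏ j, ‖Fin.init m j‖) := by
        rw [norm_smul]
        gcongr
        exact ContinuousMultilinearMap.le_opNorm _ _
    _ = ‖iteratedFDeriv ℝ k (fun y => fderiv ℝ f y (b i)) x‖ * ∏ j, ‖m j‖ := by
        rw [Fin.prod_univ_castSucc]
        simp only [Fin.init]
        ring

end NormedSpace

section Nets

variable {d : ℕ}

lemma negligible_of_comp_smul_sub_smul {w : Eps → Space d → ℂ} (hw : ∀ ε, ContDiff ℝ ∞ (w ε))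
    {t c : ℝ} (ht : |t| ≤ 1) (hc : 1 < |c|)
    (h : Negligible fun ε x => w ε (t • x) - c • w ε x) : Negligible w := by
  refine ⟨hw, fun K hK k m => ?_⟩
  obtain ⟨R, hKR⟩ := hK.isBounded.subset_closedBall (0 : Space d)
  obtain ⟨C, hC⟩ := h.2 _ (isCompact_closedBall (0 : Space d) R) k m
  have hball : Set.MapsTo (t • ·) (Metric.closedBall (0 : Space d) R) (Metric.closedBall 0 R) := by
    intro x hx
    rw [mem_closedBall_zero_iff] at hx ⊢
    rw [norm_smul]
    exact (mul_le_of_le_one_left (norm_nonneg x) ht).trans hx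
  have htc : |t ^ k| < |c| := by
    rw [abs_pow]
    exact (pow_le_one₀ (abs_nonneg t) ht).trans_lt hc
  refine ⟨C / (|c| - |t ^ k|), hC.mono fun ε hε x hx => ?_⟩
  have hwk := contDiff_natCast_of_smooth (hw ε) k
  rw [div_mul_eq_mul_div]
  refine norm_le_div_of_norm_smul_comp_sub_smul_le (isCompact_closedBall 0 R) hball
    (hwk.continuous_iteratedFDeriv le_rfl).continuousOn htc (fun y hy => ?_) (hKR hx)
  rw [← iteratedFDeriv_comp_smul_sub_smul hwk]
  exact hε y hy

/-- The partial derivative in the `i`-th coordinate of a function on `ℝ^d`. -/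
def partialFun (i : Fin d) (f : Space d → ℂ) (x : Space d) : ℂ :=
  fderiv ℝ f x (EuclideanSpace.single i 1)

lemma contDiff_partialFun {f : Space d → ℂ} (hf : ContDiff ℝ ∞ f) (i : Fin d) :
    ContDiff ℝ ∞ (partialFun i f) :=
  (hf.fderiv_right (m := ∞) le_rfl).clm_apply contDiff_const

lemma norm_iteratedFDeriv_partialFun_le {f : Space d → ℂ} {k : ℕ} (hf : ContDiff ℝ (k + 1) f)
    (i : Fin d) (x : Space d) :
    ‖iteratedFDeriv ℝ k (partialFun i f) x‖ ≤ ‖iteratedFDeriv ℝ (k + 1) f x‖ := by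
  simpa using! norm_iteratedFDeriv_fderiv_apply_le hf (EuclideanSpace.single i 1) x

lemma norm_iteratedFDeriv_succ_le_sum_partialFun {f : Space d → ℂ} {k : ℕ}
    (hf : ContDiff ℝ (k + 1) f) (x : Space d) : ‖iteratedFDeriv ℝ (k + 1) f x‖ ≤
      ∑ i, ‖iteratedFDeriv ℝ k (partialFun i f) x‖ := by
  simpa using! norm_iteratedFDeriv_succ_le_sum (EuclideanSpace.basisFun (Fin d) ℝ) hf x

lemma partialFun_comm {f : Space d → ℂ} (hf : ContDiff ℝ 2 f) (i j : Fin d) :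
    partialFun i (partialFun j f) = partialFun j (partialFun i f) :=
  funext fun x => fderiv_fderiv_apply_comm hf _ _ x

lemma moderate_partialFun {w : Eps → Space d → ℂ} (hw : Moderate w) (i : Fin d) :
    Moderate fun ε => partialFun i (w ε) := by
  refine ⟨fun ε => contDiff_partialFun (hw.1 ε) i, fun K hK k => ?_⟩
  obtain ⟨N, C, hC⟩ := hw.2 K hK (k + 1)
  exact ⟨N, C, hC.mono fun ε hε x hx =>
    (norm_iteratedFDeriv_partialFun_le (contDiff_natCast_of_smooth (hw.1 ε) (k + 1)) i x).trans
      (hε x hx)⟩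

lemma negligible_partialFun {w : Eps → Space d → ℂ} (hw : Negligible w) (i : Fin d) :
    Negligible fun ε => partialFun i (w ε) := by
  refine ⟨fun ε => contDiff_partialFun (hw.1 ε) i, fun K hK k m => ?_⟩
  obtain ⟨C, hC⟩ := hw.2 K hK (k + 1) m
  exact ⟨C, hC.mono fun ε hε x hx =>
    (norm_iteratedFDeriv_partialFun_le (contDiff_natCast_of_smooth (hw.1 ε) (k + 1)) i x).trans
      (hε x hx)⟩

lemma exists_norm_iteratedFDeriv_succ_le {w : Eps → Space d → ℂ} (hw : ∀ ε, ContDiff ℝ ∞ (w ε))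
    (h : ∀ i, Negligible fun ε => partialFun i (w ε)) {K : Set (Space d)} (hK : IsCompact K)
    (k m : ℕ) : ∃ C : ℝ, ∀ᶠ ε in epsToZero, ∀ x ∈ K,
      ‖iteratedFDeriv ℝ (k + 1) (w ε) x‖ ≤ C * (ε : ℝ) ^ m := by
  choose C hC using fun i => (h i).2 K hK k m
  refine ⟨∑ i, C i, (Filter.eventually_all.2 hC).mono fun ε hε x hx => ?_⟩
  rw [Finset.sum_mul]
  have hwk := contDiff_natCast_of_smooth (hw ε) (k + 1)
  exact (norm_iteratedFDeriv_succ_le_sum_partialFun hwk x).trans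
    (Finset.sum_le_sum fun i _ => hε i x hx)

lemma negligible_of_partialFun {w : Eps → Space d → ℂ} (hw : ∀ ε, ContDiff ℝ ∞ (w ε))
    (hw0 : ∀ ε, w ε 0 = 0) (h : ∀ i, Negligible fun ε => partialFun i (w ε)) : Negligible w := by
  refine ⟨hw, fun K hK k m => ?_⟩
  cases k with
  | succ k => exact exists_norm_iteratedFDeriv_succ_le hw h hK k m
  | zero =>
    obtain ⟨R, hKR⟩ := hK.isBounded.subset_closedBall (0 : Space d)
    obtain ⟨C, hC⟩ := exists_norm_iteratedFDeriv_succ_le hw h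
      (isCompact_closedBall (0 : Space d) R) 0 m
    refine ⟨C * R, hC.mono fun ε hε x hx => ?_⟩
    have hxR : ‖x‖ ≤ R := mem_closedBall_zero_iff.1 (hKR hx)
    have h0 : (0 : Space d) ∈ Metric.closedBall 0 R :=
      Metric.mem_closedBall_self ((norm_nonneg x).trans hxR)
    have hfderiv : ∀ y ∈ Metric.closedBall (0 : Space d) R,
        ‖fderiv ℝ (w ε) y‖ ≤ C * (ε : ℝ) ^ m := fun y hy => by
      simpa [← norm_iteratedFDeriv_fderiv] using hε y hy
    have hmvt := (convex_closedBall (0 : Space d) R).norm_image_sub_le_of_norm_fderiv_le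
      (fun y _ => (hw ε).differentiable (by simp) y) hfderiv h0 (hKR hx)
    rw [hw0, sub_zero, sub_zero] at hmvt
    rw [norm_iteratedFDeriv_zero]
    calc ‖w ε x‖ ≤ C * (ε : ℝ) ^ m * ‖x‖ := hmvt
      _ ≤ C * (ε : ℝ) ^ m * R :=
        mul_le_mul_of_nonneg_left hxR ((norm_nonneg _).trans (hfderiv 0 h0))
      _ = C * R * (ε : ℝ) ^ m := mul_right_comm _ _ _

end Nets

section Quotient

variable {d : ℕ}

lemma mk_eq_mk_iff {u v : moderateFunctions d} : GenFun.mk d u = GenFun.mk d v ↔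
    Negligible fun ε x => (u : Eps → Space d → ℂ) ε x - (v : Eps → Space d → ℂ) ε x :=
  Ideal.Quotient.eq

lemma mk_eq_zero_iff {u : moderateFunctions d} :
    GenFun.mk d u = 0 ↔ Negligible (u : Eps → Space d → ℂ) :=
  Ideal.Quotient.eq_zero_iff_mem

lemma mk_surjective : Function.Surjective (GenFun.mk d) :=
  Ideal.Quotient.mk_surjective

lemma constGen_ofReal (r : ℝ) :
    constGen d (GenComplex.mk (algebraMap ℂ moderateNumbers r)) = algebraMap ℝ (GenFun d) r :=
  rfl

lemma scale_mk (t : ℝ) (u : moderateFunctions d) :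
    scale t (GenFun.mk d u) = GenFun.mk d (scaleNet t u) :=
  rfl

lemma scale_smul (t c : ℝ) (u : GenFun d) : scale t (c • u) = c • scale t u := by
  obtain ⟨u, rfl⟩ := mk_surjective u
  rfl

lemma scale_constGen (t : ℝ) (a : GenComplex) : scale t (constGen d a) = constGen d a := by
  obtain ⟨a, rfl⟩ := Ideal.Quotient.mk_surjective a
  rfl

lemma scale_coordGen (t : ℝ) (i : Fin d) : scale t (coordGen d i) = t • coordGen d i := by
  refine congrArg (GenFun.mk d) (Subtype.ext (funext fun ε => funext fun x => ?_))
  exact Complex.ofReal_mul t (x i)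

lemma scale_inv_scale {t : ℝ} (ht : t ≠ 0) (u : GenFun d) : scale t⁻¹ (scale t u) = u := by
  obtain ⟨u, rfl⟩ := mk_surjective u
  refine congrArg (GenFun.mk d) (Subtype.ext (funext fun ε => funext fun x => ?_))
  exact congrArg ((u : Eps → Space d → ℂ) ε) (smul_inv_smul₀ ht x)

/-- The derivation of the algebra of moderate nets taking the `i`-th partial derivative of each
member. -/
def partialNet (i : Fin d) : Derivation ℝ (moderateFunctions d) (moderateFunctions d) :=
  Derivation.mk'
    { toFun := fun u => ⟨fun ε => partialFun i ((u : Eps → Space d → ℂ) ε),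
        moderate_partialFun u.2 i⟩
      map_add' := fun u v => by
        refine Subtype.ext (funext fun ε => funext fun x => ?_)
        exact DFunLike.congr_fun (fderiv_add ((u.2.1 ε).differentiable (by simp) x)
          ((v.2.1 ε).differentiable (by simp) x)) _
      map_smul' := fun c u => by
        refine Subtype.ext (funext fun ε => funext fun x => ?_)
        exact DFunLike.congr_fun (fderiv_const_smul ((u.2.1 ε).differentiable (by simp) x) c) _ }
    fun u v => by
      refine Subtype.ext (funext fun ε => funext fun x => ?_)
      exact DFunLike.congr_fun (fderiv_mul ((u.2.1 ε).differentiable (by simp) x)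
        ((v.2.1 ε).differentiable (by simp) x)) _

/-- The quotient map onto the Colombeau algebra as a homomorphism of real algebras, the form needed
to push derivations forward. -/
def mkAlgHom (d : ℕ) : moderateFunctions d →ₐ[ℝ] GenFun d :=
  { GenFun.mk d with commutes' := fun _ => rfl }

lemma mkAlgHom_partialNet_eq_zero {u : moderateFunctions d} (hu : mkAlgHom d u = 0) (i : Fin d) :
    mkAlgHom d (partialNet i u) = 0 :=
  mk_eq_zero_iff.2 (negligible_partialFun (mk_eq_zero_iff.1 hu) i)

/-- The partial derivative in the `i`-th coordinate as a derivation of the Colombeau algebra. -/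
def partialDeriv (i : Fin d) : Derivation ℝ (GenFun d) (GenFun d) :=
  Derivation.liftOfSurjective (f := mkAlgHom d) mk_surjective (d := partialNet i)
    fun _ hu => mkAlgHom_partialNet_eq_zero hu i

lemma partialDeriv_mk (i : Fin d) (u : moderateFunctions d) :
    partialDeriv i (GenFun.mk d u) = GenFun.mk d (partialNet i u) :=
  Derivation.liftOfSurjective_apply (f := mkAlgHom d) mk_surjective
    (fun _ hu => mkAlgHom_partialNet_eq_zero hu i) u

lemma partialDeriv_comm (i j : Fin d) (u : GenFun d) :
    partialDeriv i (partialDeriv j u) = partialDeriv j (partialDeriv i u) := by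
  obtain ⟨u, rfl⟩ := mk_surjective u
  simp only [partialDeriv_mk]
  refine congrArg (GenFun.mk d) (Subtype.ext (funext fun ε => ?_))
  exact partialFun_comm (contDiff_natCast_of_smooth (u.2.1 ε) 2) i j

lemma partialDeriv_coordGen (i j : Fin d) :
    partialDeriv i (coordGen d j) = if i = j then 1 else 0 := by
  have hproj (x : Space d) : HasFDerivAt (fun y : Space d => ((y j : ℝ) : ℂ))
      (Complex.ofRealCLM.comp (EuclideanSpace.proj (𝕜 := ℝ) j)) x :=
    (Complex.ofRealCLM.comp (EuclideanSpace.proj (𝕜 := ℝ) j)).hasFDerivAt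
  have hpartial (x : Space d) :
      partialFun i (fun y => ((y j : ℝ) : ℂ)) x = if i = j then 1 else 0 := by
    rw [partialFun, (hproj x).fderiv]
    split_ifs with hij
    · simp [hij]
    · simp [Ne.symm hij]
  rw [coordGen, partialDeriv_mk, ← map_one (GenFun.mk d), ← map_zero (GenFun.mk d), ← apply_ite]
  refine congrArg (GenFun.mk d) (Subtype.ext (funext fun ε => funext fun x => ?_))
  refine (hpartial x).trans ?_
  split_ifs <;> rfl

lemma partialDeriv_scale (i : Fin d) (t : ℝ) (u : GenFun d) :
    partialDeriv i (scale t u) = t • scale t (partialDeriv i u) := by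
  obtain ⟨u, rfl⟩ := mk_surjective u
  rw [scale_mk, partialDeriv_mk, partialDeriv_mk, scale_mk]
  refine congrArg (GenFun.mk d) (Subtype.ext (funext fun ε => funext fun x => ?_))
  exact DFunLike.congr_fun (fderiv_comp_smul (f := (u : Eps → Space d → ℂ) ε) (x := x) t) _

lemma moderateNum_eval {w : Eps → Space d → ℂ} (hw : Moderate w) (x : Space d) :
    ModerateNum fun ε => w ε x := by
  obtain ⟨N, C, hC⟩ := hw.2 {x} isCompact_singleton 0
  exact ⟨N, C, hC.mono fun ε hε => by simpa using hε x rfl⟩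

lemma exists_eq_constGen_of_partialDeriv_eq_zero {u : GenFun d} (h : ∀ i, partialDeriv i u = 0) :
    ∃ a, u = constGen d a := by
  obtain ⟨u, rfl⟩ := mk_surjective u
  let a : moderateNumbers := ⟨fun ε => (u : Eps → Space d → ℂ) ε 0, moderateNum_eval u.2 0⟩
  refine ⟨GenComplex.mk a, mk_eq_mk_iff.2 (negligible_of_partialFun
    (fun ε => (u.2.1 ε).sub contDiff_const) (fun ε => sub_self _) fun i => ?_)⟩
  have hpartial (ε : Eps) : partialFun i (fun x => (u : Eps → Space d → ℂ) ε x -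
      (u : Eps → Space d → ℂ) ε 0) = partialFun i ((u : Eps → Space d → ℂ) ε) :=
    funext fun x => by simp only [partialFun, fderiv_sub_const]
  have hu : Negligible fun ε => partialFun i ((u : Eps → Space d → ℂ) ε) :=
    mk_eq_zero_iff.1 ((partialDeriv_mk i u).symm.trans (h i))
  exact (congrArg Negligible (funext hpartial)).mpr hu

end Quotient

section Eigenvectors

variable {d : ℕ} {t c : ℝ} {u : GenFun d}

lemma eq_zero_of_scale_eq_smul_of_one_lt_abs (ht : |t| ≤ 1) (hc : 1 < |c|)
    (h : scale t u = c • u) : u = 0 := by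
  obtain ⟨u, rfl⟩ := mk_surjective u
  exact mk_eq_zero_iff.2 (negligible_of_comp_smul_sub_smul u.2.1 ht hc
    (mk_eq_mk_iff (u := scaleNet t u) (v := c • u).1 h))

lemma scale_inv_eq_inv_smul (ht : t ≠ 0) (h : scale t u = c • u) : scale t⁻¹ u = c⁻¹ • u := by
  have hu : u = c • scale t⁻¹ u := by rw [← scale_smul, ← h, scale_inv_scale ht]
  rcases eq_or_ne c 0 with rfl | hc
  · rw [hu]; simp
  · rw [eq_inv_smul_iff₀ hc, ← hu]

lemma ne_zero_of_scale_eq_smul (ht : t ≠ 0) (hu : u ≠ 0) (h : scale t u = c • u) : c ≠ 0 := by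
  rintro rfl
  rw [← scale_inv_scale ht u, h, zero_smul, map_zero] at hu
  exact hu rfl

lemma scale_partialDeriv (ht : t ≠ 0) (h : scale t u = c • u) (i : Fin d) :
    scale t (partialDeriv i u) = (c / t) • partialDeriv i u := by
  rw [div_eq_inv_mul, mul_smul, ← Derivation.map_smul, ← h, partialDeriv_scale, inv_smul_smul₀ ht]

lemma scale_partialDeriv_of_pow_succ (ht : t ≠ 0) {k : ℕ} (h : scale t u = t ^ (k + 1) • u)
    (i : Fin d) : scale t (partialDeriv i u) = t ^ k • partialDeriv i u := by
  rw [scale_partialDeriv ht h i, pow_succ, mul_div_cancel_right₀ _ ht]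

lemma eq_zero_of_scale_eq_smul_of_partialDeriv_eq_zero (hc : c ≠ 1) (h : scale t u = c • u)
    (hu : ∀ i, partialDeriv i u = 0) : u = 0 := by
  obtain ⟨a, rfl⟩ := exists_eq_constGen_of_partialDeriv_eq_zero hu
  rw [scale_constGen] at h
  have hsub : (1 - c) • constGen d a = 0 := by rw [sub_smul, one_smul, ← h, sub_self]
  rw [← inv_smul_smul₀ (sub_ne_zero.2 hc.symm) (constGen d a), hsub, smul_zero]

lemma partialDeriv_eq_zero_of_scale_eq_self (ht0 : t ≠ 0) (ht1 : |t| < 1) (h : scale t u = u)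
    (i : Fin d) : partialDeriv i u = 0 := by
  refine eq_zero_of_scale_eq_smul_of_one_lt_abs ht1.le ?_
    (scale_partialDeriv (c := 1) ht0 (h.trans (one_smul ℝ u).symm) i)
  rw [one_div, abs_inv]
  exact (one_lt_inv₀ (abs_pos.2 ht0)).2 ht1

lemma exists_eq_pow_of_scale_eq_smul (ht0 : t ≠ 0) (ht1 : |t| < 1) (hu : u ≠ 0)
    (h : scale t u = c • u) : ∃ k : ℕ, c = t ^ k := by
  obtain ⟨n, hn⟩ := exists_pow_lt_of_lt_one (abs_pos.2 (ne_zero_of_scale_eq_smul ht0 hu h)) ht1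
  induction n generalizing c u with
  | zero =>
    rw [pow_zero] at hn
    exact absurd (eq_zero_of_scale_eq_smul_of_one_lt_abs ht1.le hn h) hu
  | succ n ih =>
    by_cases hpartial : ∀ i, partialDeriv i u = 0
    · refine ⟨0, ?_⟩
      by_contra hc
      exact hu (eq_zero_of_scale_eq_smul_of_partialDeriv_eq_zero (by simpa using hc) h hpartial)
    · obtain ⟨i, hi⟩ := not_forall.1 hpartial
      have hn' : |t| ^ n < |c / t| := by
        rwa [abs_div, lt_div_iff₀ (abs_pos.2 ht0), ← pow_succ]
      obtain ⟨k, hk⟩ := ih hi (scale_partialDeriv ht0 h i) hn'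
      exact ⟨k + 1, by rw [pow_succ, ← hk, div_mul_cancel₀ _ ht0]⟩

end Eigenvectors

section Euler

variable {d : ℕ} {t : ℝ} {u : GenFun d} {k : ℕ}

/-- The Euler vector field `∑ i, x_i ∂_i` as a derivation of the Colombeau algebra. -/
def eulerField (d : ℕ) : Derivation ℝ (GenFun d) (GenFun d) :=
  ∑ i, coordGen d i • partialDeriv i

lemma eulerField_apply (u : GenFun d) :
    eulerField d u = ∑ i, coordGen d i * partialDeriv i u := by
  have hsum := congrFun (map_sum Derivation.coeFnAddMonoidHom
    (fun i : Fin d => coordGen d i • partialDeriv i) Finset.univ) u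
  rw [Finset.sum_apply] at hsum
  exact hsum

lemma partialDeriv_eulerField (i : Fin d) (u : GenFun d) :
    partialDeriv i (eulerField d u) = partialDeriv i u + eulerField d (partialDeriv i u) := by
  simp only [eulerField_apply, map_sum, Derivation.leibniz, partialDeriv_coordGen, smul_eq_mul,
    Finset.sum_add_distrib, mul_ite, mul_one, mul_zero, Finset.sum_ite_eq, Finset.mem_univ, if_true,
    partialDeriv_comm i]
  rw [add_comm]

lemma scale_eulerField (t : ℝ) (u : GenFun d) :
    scale t (eulerField d u) = eulerField d (scale t u) := by
  simp only [eulerField_apply, map_sum, map_mul, scale_coordGen, partialDeriv_scale, smul_mul_assoc,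
    mul_smul_comm]

lemma eulerField_eq_smul (ht0 : t ≠ 0) (ht1 : |t| < 1) (h : scale t u = t ^ k • u) :
    eulerField d u = (k : ℝ) • u := by
  induction k generalizing u with
  | zero =>
    rw [pow_zero, one_smul] at h
    simp [eulerField_apply, partialDeriv_eq_zero_of_scale_eq_self ht0 ht1 h]
  | succ k ih =>
    have hpow : t ^ (k + 1) ≠ 1 := fun hk => by
      have := pow_lt_one₀ (abs_nonneg t) ht1 k.succ_ne_zero
      rw [← abs_pow, hk, abs_one] at this
      exact this.false
    rw [← sub_eq_zero]
    refine eq_zero_of_scale_eq_smul_of_partialDeriv_eq_zero (t := t) hpow ?_ fun i => ?_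
    · rw [map_sub, scale_eulerField, scale_smul, h, Derivation.map_smul, smul_sub, smul_comm]
    · rw [map_sub, partialDeriv_eulerField, ih (scale_partialDeriv_of_pow_succ ht0 h i),
        Derivation.map_smul]
      push_cast
      module

lemma exists_eq_polyGen_of_scale_eq_pow_smul (ht0 : t ≠ 0) (ht1 : |t| < 1)
    (h : scale t u = t ^ k • u) :
    ∃ P : MvPolynomial (Fin d) GenComplex, P.IsHomogeneous k ∧ u = polyGen d P := by
  induction k generalizing u with
  | zero =>
    rw [pow_zero, one_smul] at h
    obtain ⟨a, ha⟩ := exists_eq_constGen_of_partialDeriv_eq_zero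
      (partialDeriv_eq_zero_of_scale_eq_self ht0 ht1 h)
    exact ⟨.C a, MvPolynomial.isHomogeneous_C _ a, by simp [polyGen, ha]⟩
  | succ k ih =>
    choose P hP huP using fun i => ih (scale_partialDeriv_of_pow_succ ht0 h i)
    let r : ℝ := ((k + 1 : ℕ) : ℝ)⁻¹
    refine ⟨.C (GenComplex.mk (algebraMap ℂ moderateNumbers r)) * ∑ i, .X i * P i, ?_, ?_⟩
    · rw [add_comm k, ← zero_add (1 + k)]
      exact (MvPolynomial.isHomogeneous_C _ _).mul (MvPolynomial.IsHomogeneous.sum _ _ _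
        fun i _ => (MvPolynomial.isHomogeneous_X _ i).mul (hP i))
    · have hr : ((k + 1 : ℕ) : ℝ) ≠ 0 := Nat.cast_ne_zero.2 k.succ_ne_zero
      calc u = r • eulerField d u := by rw [eulerField_eq_smul ht0 ht1 h, inv_smul_smul₀ hr]
        _ = r • ∑ i, coordGen d i * polyGen d (P i) := by simp only [eulerField_apply, huP]
        _ = _ := by
          simp only [polyGen, MvPolynomial.eval₂_mul, MvPolynomial.eval₂_C, MvPolynomial.eval₂_sum,
            MvPolynomial.eval₂_X, constGen_ofReal, Algebra.smul_def]

lemma scale_polyGen {P : MvPolynomial (Fin d) GenComplex} (hP : P.IsHomogeneous k) (t : ℝ) :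
    scale t (polyGen d P) = t ^ k • polyGen d P := by
  rw [polyGen, MvPolynomial.eval₂_eq, map_sum, Finset.smul_sum]
  refine Finset.sum_congr rfl fun s hs => ?_
  have hdeg : ∑ i ∈ s.support, s i = k := by
    simpa [Finsupp.weight_apply, Finsupp.sum] using hP (MvPolynomial.mem_support_iff.1 hs)
  simp only [map_mul, map_prod, map_pow, scale_constGen, scale_coordGen, smul_pow]
  rw [Finset.prod_smul, Finset.prod_pow_eq_pow_sum, hdeg, mul_smul_comm]

end Euler

end Colombeau

end

open Colombeau in
theorem mainTheorem2_general {d : ℕ} {t : ℝ} (ht0 : t ≠ 0) (ht1 : |t| ≠ 1) {c : ℝ}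
    {u : GenFun d} (hu : u ≠ 0) :
    scale t u = c • u ↔ ∃ k : ℕ, c = t ^ k ∧
      ∃ P : MvPolynomial (Fin d) GenComplex, P.IsHomogeneous k ∧ u = polyGen d P := by
  refine ⟨fun h => ?_, ?_⟩
  · wlog ht : |t| < 1 generalizing t c
    · have ht' : |t⁻¹| < 1 := by
        rw [abs_inv]
        exact inv_lt_one_of_one_lt₀ ((not_lt.1 ht).lt_of_ne' ht1)
      obtain ⟨k, hk, hP⟩ := this (inv_ne_zero ht0) ht'.ne (scale_inv_eq_inv_smul ht0 h) ht'
      exact ⟨k, inv_injective (hk.trans (inv_pow t k)), hP⟩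
    · obtain ⟨k, rfl⟩ := exists_eq_pow_of_scale_eq_smul ht0 ht hu h
      exact ⟨k, rfl, exists_eq_polyGen_of_scale_eq_pow_smul ht0 ht h⟩
  · rintro ⟨k, rfl, P, hP, rfl⟩
    exact scale_polyGen hP t

theorem mainTheorem2 (d : ℕ) (hd : 1 ≤ d) (α : ℝ) (u : Colombeau.GenFun d) (hu : u ≠ 0) :
    (Colombeau.IsHomogeneousOfDegree u α → ∃ k : ℕ, α = (k : ℝ)) ∧
    (Colombeau.IsHomogeneousOfDegree u α ↔
      ∃ k : ℕ, α = (k : ℝ) ∧ ∃ P : MvPolynomial (Fin d) Colombeau.GenComplex,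
        P.IsHomogeneous k ∧ u = Colombeau.polyGen d P) := by
  have hpoly (h : Colombeau.IsHomogeneousOfDegree u α) : ∃ k : ℕ, α = (k : ℝ) ∧
      ∃ P : MvPolynomial (Fin d) Colombeau.GenComplex,
        P.IsHomogeneous k ∧ u = Colombeau.polyGen d P := by
    obtain ⟨k, hk, hP⟩ := (mainTheorem2_general two_ne_zero (by norm_num) hu).1 (h 2 two_pos)
    rw [← Real.rpow_natCast, Real.rpow_right_inj two_pos (by norm_num)] at hk
    exact ⟨k, hk, hP⟩
  refine ⟨fun h => (hpoly h).imp fun _ => And.left, hpoly, ?_⟩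
  rintro ⟨k, rfl, P, hP, rfl⟩ t -
  rw [Real.rpow_natCast, Colombeau.scale_polyGen hP]
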